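/- Let $m\ge 1$, $N>0$, $\sigma_1,\dots,\sigma_m>0$, and let $\mathbf x=(\mathbf x(1),\dots,\mathbf x(m))$ be a zero-mean Gaussian random vector in $\mathbb R^m$ with covariance $\Sigma_{\mathbf x}=\mathrm{diag}(\sigma_1^2,\dots,\sigma_m^2)$. Consider the $m$ parallel channels $\mathbf y=\mathbf x+\mathbf z$, where the noise $\mathbf z\in\mathbb R^m$ is independent of $\mathbf x$, has a probability density and mean zero, and satisfies the power constraint $\mathrm{tr}(\Sigma_{\mathbf z})=\mathbb E\big[\sum_{i=1}^m \mathbf z(i)^2\big]\le N$. Mutual information is $I(\mathbf x;\mathbf y)=\int p_{\mathbf x,\mathbf y}\log\frac{p_{\mathbf x,\mathbf y}}{p_{\mathbf x}\,p_{\mathbf y}}\,\mathrm dx\,\mathrm dy\in[0,\infty]$, with $\log$ to base $2$, and the channel leakage is $L=\inf I(\mathbf x;\mathbf y)$, the infimum being over all such noise distributions. Then there is $\zeta\ge 0$ with $\sum_{i=1}^m N_i=N$, where $$N_i=\frac{\zeta}{2\left[\sqrt{1+\zeta/\sigma_i^2}+1\right]},\qquad i=1,\dots,m,$$ and for any such $\zeta$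 the infimum is attained and $$L=\min I(\mathbf x;\mathbf y)=\sum_{i=1}^m \frac12\log\left(1+\frac{\sigma_i^2}{N_i}\right).$$ -/

import Mathlib

open MeasureTheory ProbabilityTheory

noncomputable section

/-- Density of a random vector as a real-valued function. -/
def realPdf {Ω E : Type*} [MeasurableSpace Ω] [MeasureSpace E]
    (P : Measure Ω) (X : Ω → E) (e : E) : ℝ :=
  (pdf X P volume e).toReal

/-- The integrand `p_{X,Y} log₂ (p_{X,Y} / (p_X p_Y))` of mutual information. -/
def mutualInfoIntegrand {Ω E F : Type*} [MeasurableSpace Ω] [MeasureSpace E] [MeasureSpace F]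
    (P : Measure Ω) (X : Ω → E) (Y : Ω → F) (w : E × F) : ℝ :=
  realPdf P (fun ω => (X ω, Y ω)) w *
    Real.logb 2 (realPdf P (fun ω => (X ω, Y ω)) w / (realPdf P X w.1 * realPdf P Y w.2))

/-- Mutual information (in bits) of two random vectors with a joint density:
`I(X;Y) = ∫ p_{X,Y} log₂ (p_{X,Y} / (p_X p_Y))`, as an extended real: the integral of the positive
part (possibly `∞`) minus that of the negative part. The latter is finite for every pair with a
joint density, because `t log t ≥ -1/e`, so the difference is never of the form `∞ - ∞`. -/
def mutualInfo {Ω E F : Type*} [MeasurableSpace Ω] [MeasureSpace E] [MeasureSpace F]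
    (P : Measure Ω) (X : Ω → E) (Y : Ω → F) : EReal :=
  ((∫⁻ w : E × F, ENNReal.ofReal (mutualInfoIntegrand P X Y w) : ENNReal) : EReal) -
    ((∫⁻ w : E × F, ENNReal.ofReal (-mutualInfoIntegrand P X Y w) : ENNReal) : EReal)

/-- `z` is a noise allowed for the input `x` under the power budget `N`: a zero-mean random vector
with a density and finite second moments, independent of `x`, with
`tr Σ_z = E[∑ z(i)²] ≤ N`. -/
structure IsAllowedNoise {Ω : Type*} [MeasurableSpace Ω] {m : ℕ} (P : Measure Ω)
    (x z : Ω → EuclideanSpace ℝ (Fin m)) (N : ℝ) : Prop where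
  hasPDF : HasPDF z P volume
  memLp : MemLp z 2 P
  mean_zero : ∫ ω, z ω ∂P = 0
  indep : IndepFun x z P
  power : ∫ ω, ∑ i, (z ω i) ^ 2 ∂P ≤ N

/-- All values `I(x; x + z)` where `x` has the given law `μx` and `z` is an allowed noise. -/
def leakageValues {m : ℕ} (μx : Measure (EuclideanSpace ℝ (Fin m))) (N : ℝ) : Set EReal :=
  {I | ∃ (Ω : Type) (_ : MeasurableSpace Ω) (P : Measure Ω) (_ : IsProbabilityMeasure P)
      (x z : Ω → EuclideanSpace ℝ (Fin m)),
      HasLaw x μx P ∧ IsAllowedNoise P x z N ∧ I = mutualInfo P x (fun ω => x ω + z ω)}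

/-- Leakage of the channel `y = x + z`, with input law `μx` and noise power budget `N`: the infimum
of `I(x; y)` over all allowed noise distributions. -/
def channelLeakage {m : ℕ} (μx : Measure (EuclideanSpace ℝ (Fin m))) (N : ℝ) : EReal :=
  sInf (leakageValues μx N)

/-- The noise power `ζ / (2 (√(1 + ζ/s) + 1))` allotted to a channel with input variance `s`. -/
def obfuscatingPower (ζ s : ℝ) : ℝ :=
  ζ / (2 * (Real.sqrt (1 + ζ / s) + 1))

end

/-! Write `s i` for the input variances and `n i` for the powers `obfuscatingPower ζ (s i)`. Let `R
= p_{y|x} / p_y` be the ratio for the Gaussian channel with noise variances `n` (`channelRatio`).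
For any allowed noise, with output density `p_y`, the function `p_x p_y R` is `p_y` times the
Gaussian backward channel, so its mass is at most one (`lintegral_backwardChannel_le`). Gibbs'
inequality then gives `I(x;y) ≥ E log₂ R(x,y)` (`le_mutualInfo`), with equality for the Gaussian
noise itself (`mutualInfo_diagGaussian`).

Since `log R` is quadratic, its expectation depends on the noise only through the second moments `M
i`. The choice of `n` satisfies `n i * (s i + n i) = ζ * s i / 4`, which gives every `M i` the same
coefficient `-2/ζ` (`quadratic_gap_eq`). The bound therefore exceeds the claimed value by a positive
multiple of `N - ∑ M i`, which the power constraint makes nonnegative. No separate reduction to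
Gaussian noise or optimisation over powers is needed. -/

open scoped NNReal in
/-- The density of the centered Gaussian vector with independent coordinates of variances `v i`. -/
noncomputable def diagGaussianPDF {m : ℕ} (v : Fin m → ℝ≥0) (e : EuclideanSpace ℝ (Fin m)) : ℝ :=
  ∏ i, gaussianPDFReal 0 (v i) (e i)

open scoped NNReal in
/-- The centered Gaussian law on `ℝᵐ` with independent coordinates of variances `v i`. -/
noncomputable def diagGaussian {m : ℕ} (v : Fin m → ℝ≥0) : Measure (EuclideanSpace ℝ (Fin m)) :=
  (Measure.pi fun i => gaussianReal 0 (v i)).map (WithLp.toLp 2)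

/-! ### Gaussian vectors with diagonal covariance: densities, convolution, moments. -/

section DiagGaussian

open scoped NNReal ENNReal

variable {m : ℕ} (v w : Fin m → ℝ≥0)

instance isProbabilityMeasure_diagGaussian : IsProbabilityMeasure (diagGaussian v) :=
  Measure.isProbabilityMeasure_map (by fun_prop)

lemma measurable_diagGaussianPDF : Measurable (diagGaussianPDF v) := by
  unfold diagGaussianPDF
  refine Finset.measurable_prod _ fun i _ => ?_
  exact (measurable_gaussianPDFReal 0 (v i)).comp (by fun_prop)

variable {v} in
lemma diagGaussianPDF_pos (hv : ∀ i, v i ≠ 0) (e : EuclideanSpace ℝ (Fin m)) :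
    0 < diagGaussianPDF v e :=
  Finset.prod_pos fun i _ => gaussianPDFReal_pos _ _ _ (hv i)

lemma measurePreserving_eval_diagGaussian (i : Fin m) :
    MeasurePreserving (fun e : EuclideanSpace ℝ (Fin m) => e i) (diagGaussian v)
      (gaussianReal 0 (v i)) where
  measurable := by fun_prop
  map_eq := by
    rw [diagGaussian, Measure.map_map (by fun_prop) (by fun_prop)]
    exact (measurePreserving_eval (fun i => gaussianReal 0 (v i)) i).map_eq

lemma charFun_diagGaussian (t : EuclideanSpace ℝ (Fin m)) :
    charFun (diagGaussian v) t = ∏ i, charFun (gaussianReal 0 (v i)) (t i) :=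
  charFun_pi t

lemma diagGaussian_conv_diagGaussian :
    (diagGaussian v).conv (diagGaussian w) = diagGaussian (v + w) := by
  apply Measure.ext_of_charFun
  ext t
  rw [charFun_conv, charFun_diagGaussian, charFun_diagGaussian, charFun_diagGaussian,
    ← Finset.prod_mul_distrib]
  refine Finset.prod_congr rfl fun i _ => ?_
  rw [← charFun_conv, gaussianReal_conv_gaussianReal]
  simp

-- It suffices to compare the two measures on boxes, where the indicator of the box and the density
-- both factor over coordinates.
variable {v} in
lemma pi_gaussianReal_eq_withDensity (hv : ∀ i, v i ≠ 0) :
    Measure.pi (fun i => gaussianReal 0 (v i)) =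
      volume.withDensity fun e : Fin m → ℝ =>
        ENNReal.ofReal (∏ i, gaussianPDFReal 0 (v i) (e i)) := by
  refine Measure.pi_eq fun s hs => ?_
  have hS : MeasurableSet (Set.univ.pi s) := MeasurableSet.univ_pi hs
  rw [withDensity_apply _ hS, ← lintegral_indicator hS]
  have hint : ∀ i, Integrable ((s i).indicator (gaussianPDFReal 0 (v i))) := fun i =>
    (integrable_gaussianPDFReal 0 (v i)).indicator (hs i)
  have hpt : ∀ e : Fin m → ℝ, (Set.univ.pi s).indicator
      (fun e => ENNReal.ofReal (∏ i, gaussianPDFReal 0 (v i) (e i))) e =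
      ENNReal.ofReal (∏ i, (s i).indicator (gaussianPDFReal 0 (v i)) (e i)) := by
    intro e
    by_cases he : e ∈ Set.univ.pi s
    · rw [Set.indicator_of_mem he]
      congr 1
      exact Finset.prod_congr rfl fun i _ => (Set.indicator_of_mem (he i trivial) _).symm
    · rw [Set.indicator_of_notMem he]
      simp only [Set.mem_univ_pi, not_forall] at he
      obtain ⟨i, hi⟩ := he
      rw [Finset.prod_eq_zero (Finset.mem_univ i) (Set.indicator_of_notMem hi _),
        ENNReal.ofReal_zero]
  have hnn : ∀ i x, 0 ≤ (s i).indicator (gaussianPDFReal 0 (v i)) x := fun i x =>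
    Set.indicator_nonneg (fun y _ => gaussianPDFReal_nonneg 0 (v i) y) x
  rw [lintegral_congr hpt, volume_pi,
    ← ofReal_integral_eq_lintegral_ofReal (Integrable.fintype_prod hint)
    (ae_of_all _ fun e => Finset.prod_nonneg fun i _ => hnn i (e i)),
    integral_fintype_prod_eq_prod, ENNReal.ofReal_prod_of_nonneg
    fun i _ => integral_nonneg (hnn i)]
  refine Finset.prod_congr rfl fun i _ => ?_
  rw [gaussianReal_apply_eq_integral 0 (hv i), integral_indicator (hs i)]

variable {v} in
lemma diagGaussian_eq_withDensity (hv : ∀ i, v i ≠ 0) :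
    diagGaussian v = volume.withDensity fun e => ENNReal.ofReal (diagGaussianPDF v e) := by
  have hm : Measurable fun e => ENNReal.ofReal (diagGaussianPDF v e) :=
    (measurable_diagGaussianPDF v).ennreal_ofReal
  rw [diagGaussian, pi_gaussianReal_eq_withDensity hv]
  ext s hs
  rw [Measure.map_apply (by fun_prop) hs, withDensity_apply _ hs,
    withDensity_apply _ (hs.preimage (by fun_prop)),
    ← (PiLp.volume_preserving_toLp (Fin m)).setLIntegral_comp_preimage hs hm]
  rfl

variable {v w} in
/-- The Gaussian densities convolve: integrating the input out of the joint density of the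
Gaussian channel gives the output density. -/
lemma lintegral_diagGaussianPDF_mul (hv : ∀ i, v i ≠ 0) (hw : ∀ i, w i ≠ 0) :
    (fun y => ∫⁻ x, ENNReal.ofReal (diagGaussianPDF v x) *
      ENNReal.ofReal (diagGaussianPDF w (y - x))) =ᵐ[volume]
    fun y => ENNReal.ofReal (diagGaussianPDF (v + w) y) := by
  have hvw : ∀ i, (v + w) i ≠ 0 := fun i => by simp [hv i]
  have hmv := (measurable_diagGaussianPDF v).ennreal_ofReal
  have hmw := (measurable_diagGaussianPDF w).ennreal_ofReal
  -- Both sides are densities of this one measure, hence equal almost everywhere.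
  have h := diagGaussian_conv_diagGaussian v w
  rw [diagGaussian_eq_withDensity hv, diagGaussian_eq_withDensity hw,
    diagGaussian_eq_withDensity hvw, conv_withDensity_eq_lconvolution hmv hmw,
    withDensity_eq_iff_of_sigmaFinite (by fun_prop)
      (measurable_diagGaussianPDF _).ennreal_ofReal.aemeasurable] at h
  filter_upwards [h] with y hy
  rw [← hy, lconvolution_def]
  simp only [neg_add_eq_sub]

/-- A Gaussian vector with diagonal covariance has independent coordinates. -/
lemma map_eq_diagGaussian {Ω : Type*} [MeasurableSpace Ω] {P : Measure Ω} [IsProbabilityMeasure P]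
    {x : Ω → EuclideanSpace ℝ (Fin m)} (hx : HasGaussianLaw x P) (hx_mean : ∫ ω, x ω ∂P = 0)
    (hx_cov : Matrix.of (fun i j : Fin m => cov[fun ω => x ω i, fun ω => x ω j; P]) =
      Matrix.diagonal (fun i => (v i : ℝ))) :
    P.map x = diagGaussian v := by
  have hcov : ∀ i j, cov[fun ω => x ω i, fun ω => x ω j; P] =
      Matrix.diagonal (fun i => (v i : ℝ)) i j := fun i j => congrFun (congrFun hx_cov i) j
  have hx' : HasGaussianLaw (fun ω i => x ω i) P :=
    hx.map_equiv_fun (PiLp.continuousLinearEquiv 2 ℝ fun _ : Fin m => ℝ)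
  have hind : iIndepFun (fun i ω => x ω i) P :=
    HasGaussianLaw.iIndepFun_of_covariance_eq_zero hx' fun i j hij => by
      rw [hcov, Matrix.diagonal_apply_ne _ hij]
  have hlaw : ∀ i, HasLaw (fun ω => x ω i) (gaussianReal 0 (v i)) P := fun i => by
    refine ⟨(hx'.eval i).aemeasurable, ?_⟩
    rw [(hx'.eval i).map_eq_gaussianReal]
    have h0 : ∫ ω, x ω i ∂P = 0 := by
      have := (EuclideanSpace.proj i : EuclideanSpace ℝ (Fin m) →L[ℝ] ℝ).integral_comp_comm
        hx.integrable
      simpa [hx_mean] using this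
    have h1 : Var[fun ω => x ω i; P] = v i := by
      rw [← covariance_self (hx'.eval i).aemeasurable, hcov, Matrix.diagonal_apply_eq]
    rw [h0, h1, Real.toNNReal_coe]
  have h := ((iIndepFun_iff_hasLaw_pi_pi hlaw).1 hind).map_eq
  rw [diagGaussian, ← h, AEMeasurable.map_map_of_aemeasurable (by fun_prop) hx'.aemeasurable]
  rfl

lemma memLp_id_diagGaussian : MemLp id 2 (diagGaussian v) :=
  memLp_piLp_iff.2 fun i =>
    (memLp_id_gaussianReal 2).comp_measurePreserving (measurePreserving_eval_diagGaussian v i)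

lemma integral_id_diagGaussian : ∫ e, e ∂(diagGaussian v) = 0 := by
  ext i
  have h := (EuclideanSpace.proj i : EuclideanSpace ℝ (Fin m) →L[ℝ] ℝ).integral_comp_comm
    ((memLp_id_diagGaussian v).integrable one_le_two)
  have h' := integral_id_gaussianReal (μ := 0) (v := v i)
  rw [← (measurePreserving_eval_diagGaussian v i).map_eq,
    integral_map (by fun_prop) (by fun_prop)] at h'
  exact h.symm.trans h'

lemma integral_eval_sq_diagGaussian (i : Fin m) : ∫ e, (e i) ^ 2 ∂(diagGaussian v) = v i := by
  have h := variance_id_gaussianReal (μ := 0) (v := v i)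
  rw [variance_eq_integral (by fun_prop)] at h
  simp only [integral_id_gaussianReal, id, sub_zero] at h
  rw [← h, ← (measurePreserving_eval_diagGaussian v i).map_eq,
    integral_map (by fun_prop) (by fun_prop)]

end DiagGaussian

/-! ### Lower bound on mutual information, and equality for Gaussian noise. -/

section MutualInfo

open scoped NNReal ENNReal

lemma coe_integral_eq_lintegral_sub {α : Type*} [MeasurableSpace α] {μ : Measure α} {G : α → ℝ}
    (hG : Integrable G μ) :
    ((∫ a, G a ∂μ : ℝ) : EReal) =
      ((∫⁻ a, ENNReal.ofReal (G a) ∂μ : ℝ≥0∞) : EReal) -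
        ((∫⁻ a, ENNReal.ofReal (-G a) ∂μ : ℝ≥0∞) : EReal) := by
  have hp : ∫⁻ a, ENNReal.ofReal (G a) ∂μ ≠ ∞ := hG.lintegral_lt_top.ne
  have hn : ∫⁻ a, ENNReal.ofReal (-G a) ∂μ ≠ ∞ := hG.neg.lintegral_lt_top.ne
  rw [integral_eq_lintegral_pos_part_sub_lintegral_neg_part hG, EReal.coe_sub,
    EReal.coe_ennreal_toReal hp, EReal.coe_ennreal_toReal hn]

/-- Only the minorant `G` has to be integrable, so infinite mutual information is covered. -/
lemma coe_integral_le_lintegral_sub {α : Type*} [MeasurableSpace α] {μ : Measure α} {F G : α → ℝ}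
    (hG : Integrable G μ) (hGF : G ≤ᵐ[μ] F) :
    ((∫ a, G a ∂μ : ℝ) : EReal) ≤
      ((∫⁻ a, ENNReal.ofReal (F a) ∂μ : ℝ≥0∞) : EReal) -
        ((∫⁻ a, ENNReal.ofReal (-F a) ∂μ : ℝ≥0∞) : EReal) := by
  rw [coe_integral_eq_lintegral_sub hG]
  refine EReal.sub_le_sub ?_ ?_ <;> rw [EReal.coe_ennreal_le_coe_ennreal_iff] <;>
    refine lintegral_mono_ae ?_ <;> filter_upwards [hGF] with a ha <;>
    exact ENNReal.ofReal_le_ofReal (by simpa using ha)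

/-- The pointwise form of Gibbs' inequality: `p log (p / r) ≥ p log ρ + p - r ρ`. -/
lemma mul_log_div_ge {p r ρ : ℝ} (hp : 0 ≤ p) (hr : 0 ≤ r) (hpr : p ≠ 0 → 0 < r) (hρ : 0 < ρ) :
    p * Real.log ρ + p - r * ρ ≤ p * Real.log (p / r) := by
  rcases eq_or_lt_of_le hp with rfl | hp'
  · simp only [zero_mul, zero_add, zero_sub, Left.neg_nonpos_iff]
    positivity
  · have hr' := hpr hp'.ne'
    -- This is `log t ≤ t - 1` at `t = r ρ / p`; multiplying by `p` gives the claim.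
    have h := Real.log_le_sub_one_of_pos (show 0 < r * ρ / p by positivity)
    rw [Real.log_div (by positivity) hp'.ne', Real.log_mul hr'.ne' hρ.ne'] at h
    rw [Real.log_div hp'.ne' hr'.ne']
    have h2 := mul_le_mul_of_nonneg_left h hp
    have h3 : p * (r * ρ / p - 1) = r * ρ - p := by field_simp
    rw [h3] at h2
    linarith

variable {Ω : Type*} [MeasurableSpace Ω] {P : Measure Ω} [IsProbabilityMeasure P] {m : ℕ}

/-- The density of an additive-noise channel's input-output pair. -/
lemma hasLaw_prodMk_add {E : Type*} [NormedAddCommGroup E] [NormedSpace ℝ E]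
    [FiniteDimensional ℝ E] [MeasureSpace E] [BorelSpace E]
    [(volume : Measure E).IsAddHaarMeasure]
    {x z : Ω → E} {f h : E → ℝ≥0∞} (hf : Measurable f) (hh : Measurable h)
    (hx : HasLaw x (volume.withDensity f) P) (hz : HasLaw z (volume.withDensity h) P)
    (hxz : IndepFun x z P) :
    HasLaw (fun ω => (x ω, x ω + z ω))
      (volume.withDensity fun w : E × E => f w.1 * h (w.2 - w.1)) P := by
  have := hx.isProbabilityMeasure_iff.1 inferInstance
  have := hz.isProbabilityMeasure_iff.1 inferInstance
  have hlaw := (indepFun_iff_hasLaw_prodMk_prod hx hz).1 hxz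
  rw [prod_withDensity hf hh] at hlaw
  -- The shear `(x, z) ↦ (x, x + z)` preserves volume, so the product density is only re-expressed
  -- in the new variables.
  have hmap : (((volume : Measure E).prod (volume : Measure E)).withDensity
      fun w => f w.1 * h w.2).map (fun w : E × E => (w.1, w.1 + w.2)) =
      volume.withDensity fun w : E × E => f w.1 * h (w.2 - w.1) := by
    ext s hs
    have hm : Measurable fun w : E × E => (w.1, w.1 + w.2) := by fun_prop
    rw [Measure.map_apply hm hs, withDensity_apply _ hs, withDensity_apply _ (hm hs),
      Measure.volume_eq_prod,
      ← (measurePreserving_prod_add volume volume).setLIntegral_comp_preimage hs (by fun_prop)]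
    simp
  refine ⟨?_, ?_⟩
  · have := hx.aemeasurable
    have := hz.aemeasurable
    fun_prop
  · rw [← hmap, ← hlaw.map_eq, AEMeasurable.map_map_of_aemeasurable (by fun_prop) hlaw.aemeasurable]
    rfl

lemma hasPDF_prodMk_add {E : Type*} [NormedAddCommGroup E] [NormedSpace ℝ E]
    [FiniteDimensional ℝ E] [MeasureSpace E] [BorelSpace E]
    [(volume : Measure E).IsAddHaarMeasure]
    {x z : Ω → E} {f h : E → ℝ≥0∞} (hf : Measurable f) (hh : Measurable h)
    (hx : HasLaw x (volume.withDensity f) P) (hz : HasLaw z (volume.withDensity h) P)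
    (hxz : IndepFun x z P) :
    HasPDF (fun ω => (x ω, x ω + z ω)) P volume ∧
      pdf (fun ω => (x ω, x ω + z ω)) P volume =ᵐ[volume] fun w => f w.1 * h (w.2 - w.1) := by
  have hlaw := hasLaw_prodMk_add hf hh hx hz hxz
  have hpdf := hasPDF_of_map_eq_withDensity hlaw.aemeasurable _
    (by fun_prop) hlaw.map_eq
  exact ⟨hpdf, (pdf.eq_of_map_eq_withDensity _ (by fun_prop)).1 hlaw.map_eq⟩

lemma pdf_ae_eq_of_hasLaw_withDensity {E : Type*} [MeasureSpace E]
    {x : Ω → E} {f : E → ℝ≥0∞} (hf : Measurable f) (hx : HasLaw x (volume.withDensity f) P) :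
    pdf x P volume =ᵐ[volume] f := by
  have := hasPDF_of_map_eq_withDensity hx.aemeasurable _ hf.aemeasurable hx.map_eq
  exact (pdf.eq_of_map_eq_withDensity _ hf.aemeasurable).1 hx.map_eq

lemma realPdf_ae_eq_diagGaussianPDF {s : Fin m → ℝ≥0} (hs : ∀ i, s i ≠ 0)
    {x : Ω → EuclideanSpace ℝ (Fin m)} (hx : HasLaw x (diagGaussian s) P) :
    realPdf P x =ᵐ[volume] diagGaussianPDF s := by
  rw [diagGaussian_eq_withDensity hs] at hx
  filter_upwards [pdf_ae_eq_of_hasLaw_withDensity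
    (measurable_diagGaussianPDF s).ennreal_ofReal hx] with e he
  rw [realPdf, he, ENNReal.toReal_ofReal (diagGaussianPDF_pos hs e).le]

/-- The ratio `p_{y|x} / p_y` for the Gaussian channel with input variances `s` and noise
variances `n`. -/
noncomputable def channelRatio (s n : Fin m → ℝ≥0)
    (w : EuclideanSpace ℝ (Fin m) × EuclideanSpace ℝ (Fin m)) : ℝ :=
  diagGaussianPDF n (w.2 - w.1) / diagGaussianPDF (s + n) w.2

lemma measurable_channelRatio (s n : Fin m → ℝ≥0) : Measurable (channelRatio s n) :=
  ((measurable_diagGaussianPDF n).comp (by fun_prop)).div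
    ((measurable_diagGaussianPDF (s + n)).comp (by fun_prop))

lemma channelRatio_pos {s n : Fin m → ℝ≥0} (hn : ∀ i, n i ≠ 0)
    (w : EuclideanSpace ℝ (Fin m) × EuclideanSpace ℝ (Fin m)) : 0 < channelRatio s n w :=
  div_pos (diagGaussianPDF_pos hn _) (diagGaussianPDF_pos (fun i => by simp [hn i]) _)

lemma log_gaussianPDFReal {v : ℝ≥0} (hv : v ≠ 0) (t : ℝ) :
    Real.log (gaussianPDFReal 0 v t) =
      -(1 / 2 * Real.log (2 * Real.pi * v)) - t ^ 2 / (2 * v) := by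
  have hv' : (0 : ℝ) < v := by positivity
  rw [gaussianPDFReal, Real.log_mul (by positivity) (Real.exp_pos _).ne', Real.log_exp,
    Real.log_inv, Real.log_sqrt (by positivity)]
  ring_nf

/-- In terms of input `a` and noise `e` the log-ratio is quadratic, so its expectation needs only
second moments. -/
lemma log_channelRatio {s n : Fin m → ℝ≥0} (hn : ∀ i, n i ≠ 0)
    (a e : EuclideanSpace ℝ (Fin m)) :
    Real.log (channelRatio s n (a, a + e)) =
      ∑ i, (1 / 2 * Real.log (1 + (s i : ℝ) / n i) + (a i + e i) ^ 2 / (2 * (s i + n i)) -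
        (e i) ^ 2 / (2 * n i)) := by
  have hsn : ∀ i, (s + n) i ≠ 0 := fun i => by simp [hn i]
  rw [channelRatio, Real.log_div (diagGaussianPDF_pos hn _).ne' (diagGaussianPDF_pos hsn _).ne',
    diagGaussianPDF, diagGaussianPDF,
    Real.log_prod fun i _ => (gaussianPDFReal_pos _ _ _ (hn i)).ne',
    Real.log_prod fun i _ => (gaussianPDFReal_pos _ _ _ (hsn i)).ne', ← Finset.sum_sub_distrib]
  refine Finset.sum_congr rfl fun i _ => ?_
  have hn' : (0 : ℝ) < n i := by have := hn i; positivity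
  rw [log_gaussianPDFReal (hn i), log_gaussianPDFReal (hsn i)]
  have h : 2 * Real.pi * (((s + n) i : ℝ≥0) : ℝ) = 2 * Real.pi * n i * (1 + (s i : ℝ) / n i) := by
    rw [Pi.add_apply, NNReal.coe_add]
    field_simp
    ring
  rw [h, Real.log_mul (x := 2 * Real.pi * n i) (by positivity) (by positivity)]
  simp only [add_sub_cancel_left, PiLp.add_apply, Pi.add_apply, NNReal.coe_add]
  ring

/-- The expected log-ratio of the Gaussian channel, under an arbitrary noise of finite power. -/
lemma integrable_log_channelRatio {s n : Fin m → ℝ≥0} (hn : ∀ i, n i ≠ 0)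
    {x z : Ω → EuclideanSpace ℝ (Fin m)} (hx : HasLaw x (diagGaussian s) P)
    (hz : MemLp z 2 P) (hz0 : ∫ ω, z ω ∂P = 0) (hxz : IndepFun x z P) :
    Integrable (fun ω => Real.log (channelRatio s n (x ω, x ω + z ω))) P ∧
      ∫ ω, Real.log (channelRatio s n (x ω, x ω + z ω)) ∂P =
        ∑ i, (1 / 2 * Real.log (1 + (s i : ℝ) / n i) +
          (s i + ∫ ω, (z ω i) ^ 2 ∂P) / (2 * (s i + n i)) -
          (∫ ω, (z ω i) ^ 2 ∂P) / (2 * n i)) := by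
  have hxm : MemLp x 2 P := by
    have := memLp_id_diagGaussian s
    rw [← hx.map_eq, memLp_map_measure_iff (by fun_prop) hx.aemeasurable] at this
    exact this
  have hzi : ∀ i, MemLp (fun ω => z ω i) 2 P := fun i => hz.eval_piLp i
  have hxi : ∀ i, MemLp (fun ω => x ω i) 2 P := fun i => hxm.eval_piLp i
  have hz0i : ∀ i, ∫ ω, z ω i ∂P = 0 := fun i => by
    have := (EuclideanSpace.proj i : EuclideanSpace ℝ (Fin m) →L[ℝ] ℝ).integral_comp_comm
      (hz.integrable one_le_two)
    simpa [hz0] using this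
  -- Independence and the zero mean of the noise remove the cross term.
  have hxzi : ∀ i, ∫ ω, x ω i * z ω i ∂P = 0 := fun i => by
    have hind : IndepFun (fun ω => x ω i) (fun ω => z ω i) P :=
      hxz.comp (φ := fun e : EuclideanSpace ℝ (Fin m) => e i)
        (ψ := fun e : EuclideanSpace ℝ (Fin m) => e i) (by fun_prop) (by fun_prop)
    rw [hind.integral_fun_mul_eq_mul_integral (hxi i).aestronglyMeasurable
      (hzi i).aestronglyMeasurable, hz0i, mul_zero]
  have hxsq : ∀ i, ∫ ω, (x ω i) ^ 2 ∂P = s i := fun i => by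
    rw [← integral_eval_sq_diagGaussian s i]
    exact hx.integral_comp (f := fun e => (e i) ^ 2) (by fun_prop)
  have hys : ∀ i, ∫ ω, (x ω i + z ω i) ^ 2 ∂P = s i + ∫ ω, (z ω i) ^ 2 ∂P := fun i => by
    have h : ∀ ω, (x ω i + z ω i) ^ 2 = (x ω i) ^ 2 + 2 * (x ω i * z ω i) + (z ω i) ^ 2 :=
      fun ω => by ring
    simp_rw [h]
    have h1 : Integrable (fun ω => 2 * (x ω i * z ω i)) P :=
      ((hxi i).integrable_mul (hzi i)).const_mul 2
    have h2 : Integrable (fun ω => (x ω i) ^ 2 + 2 * (x ω i * z ω i)) P :=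
      (hxi i).integrable_sq.add h1
    rw [integral_add h2 (hzi i).integrable_sq, integral_add (hxi i).integrable_sq h1,
      integral_const_mul, hxzi, hxsq]
    ring
  have hyi : ∀ i, Integrable (fun ω => (x ω i + z ω i) ^ 2) P := fun i =>
    ((hxi i).add (hzi i)).integrable_sq
  have hA : ∀ i, Integrable (fun ω => 1 / 2 * Real.log (1 + (s i : ℝ) / n i) +
      (x ω i + z ω i) ^ 2 / (2 * (s i + n i))) P := fun i =>
    (integrable_const _).add ((hyi i).div_const _)
  have hB : ∀ i, Integrable (fun ω => (z ω i) ^ 2 / (2 * (n i : ℝ))) P := fun i =>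
    (hzi i).integrable_sq.div_const _
  have hAB : ∀ i ∈ Finset.univ, Integrable (fun ω => 1 / 2 * Real.log (1 + (s i : ℝ) / n i) +
      (x ω i + z ω i) ^ 2 / (2 * (s i + n i)) - (z ω i) ^ 2 / (2 * (n i : ℝ))) P :=
    fun i _ => (hA i).sub (hB i)
  simp_rw [log_channelRatio hn]
  refine ⟨integrable_finsetSum _ hAB, ?_⟩
  rw [integral_finsetSum _ hAB]
  refine Finset.sum_congr rfl fun i _ => ?_
  rw [integral_sub (hA i) (hB i), integral_add (integrable_const _) ((hyi i).div_const _),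
    integral_div, integral_div, hys]
  simp

/-- The Gaussian backward channel applied to an arbitrary output density has total mass at
most one. -/
lemma lintegral_backwardChannel_le {s n : Fin m → ℝ≥0} (hs : ∀ i, s i ≠ 0) (hn : ∀ i, n i ≠ 0)
    {g : EuclideanSpace ℝ (Fin m) → ℝ≥0∞} (hg : Measurable g) (hg1 : ∫⁻ y, g y ≤ 1) :
    ∫⁻ w : EuclideanSpace ℝ (Fin m) × EuclideanSpace ℝ (Fin m),
      ENNReal.ofReal (diagGaussianPDF s w.1 * (g w.2).toReal * channelRatio s n w) ≤ 1 := by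
  have hsn : ∀ i, (s + n) i ≠ 0 := fun i => by simp [hn i]
  have hms := measurable_diagGaussianPDF s
  have hmn := measurable_diagGaussianPDF n
  have hmsn := measurable_diagGaussianPDF (s + n)
  have hmr := measurable_channelRatio s n
  -- Integrate over `x` first: for fixed `y`, the Gaussian integral produces exactly the denominator
  -- of `channelRatio`, leaving `g y`.
  rw [Measure.volume_eq_prod, lintegral_prod_symm' _ (by fun_prop)]
  refine le_trans (lintegral_mono_ae ?_) hg1
  filter_upwards [lintegral_diagGaussianPDF_mul hs hn] with y hy
  have h : ∀ x, ENNReal.ofReal (diagGaussianPDF s x * (g y).toReal * channelRatio s n (x, y)) =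
      ENNReal.ofReal ((g y).toReal / diagGaussianPDF (s + n) y) *
        (ENNReal.ofReal (diagGaussianPDF s x) * ENNReal.ofReal (diagGaussianPDF n (y - x))) := by
    intro x
    have h1 := (diagGaussianPDF_pos hs x).le
    have h2 := (diagGaussianPDF_pos hn (y - x)).le
    have h3 := (diagGaussianPDF_pos hsn y).le
    rw [← ENNReal.ofReal_mul h1, ← ENNReal.ofReal_mul (by positivity), channelRatio]
    congr 1
    ring
  simp_rw [h]
  have h3 := diagGaussianPDF_pos hsn y
  rw [lintegral_const_mul _ (by fun_prop), hy, ← ENNReal.ofReal_mul (by positivity),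
    div_mul_cancel₀ _ h3.ne']
  exact ENNReal.ofReal_toReal_le

/-- Against any noise, the mutual information of a Gaussian input with the output is at least the
expected log-ratio of a Gaussian channel. -/
lemma le_mutualInfo {s n : Fin m → ℝ≥0} (hs : ∀ i, s i ≠ 0) (hn : ∀ i, n i ≠ 0)
    {x z : Ω → EuclideanSpace ℝ (Fin m)} (hx : HasLaw x (diagGaussian s) P)
    (hzpdf : HasPDF z P volume) (hxz : IndepFun x z P)
    (hint : Integrable (fun ω => Real.log (channelRatio s n (x ω, x ω + z ω))) P) :
    (((∫ ω, Real.log (channelRatio s n (x ω, x ω + z ω)) ∂P) / Real.log 2 : ℝ) : EReal) ≤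
      mutualInfo P x (fun ω => x ω + z ω) := by
  have hms := measurable_diagGaussianPDF s
  have hmr := measurable_channelRatio s n
  have hx' := hx
  rw [diagGaussian_eq_withDensity hs] at hx'
  obtain ⟨hpdf, -⟩ := hasPDF_prodMk_add hms.ennreal_ofReal (measurable_pdf z P volume) hx'
    HasPDF.hasLaw hxz
  have hy : HasPDF (fun ω => x ω + z ω) P volume :=
    pdf.quasiMeasurePreserving_hasPDF' (fun ω => (x ω, x ω + z ω)) (g := Prod.snd)
      (μ := volume) Measure.quasiMeasurePreserving_snd
  set Y := fun ω => x ω + z ω with hY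
  set W := fun ω => (x ω, x ω + z ω) with hW
  have hlog2 : 0 < Real.log 2 := Real.log_pos one_lt_two
  have hmlog : AEStronglyMeasurable (fun w => Real.log (channelRatio s n w)) volume :=
    hmr.log.aestronglyMeasurable
  have hp : Integrable (fun w => realPdf P W w) volume := by
    have h : Integrable (fun w => (pdf W P volume w).toReal • (1 : ℝ)) volume :=
      (pdf.integrable_pdf_smul_iff (by fun_prop)).2 (integrable_const _)
    simpa [realPdf] using h
  have hp1 : ∫ w, realPdf P W w = 1 := by
    have h : ∫ w, (pdf W P volume w).toReal • (1 : ℝ) = ∫ _, (1 : ℝ) ∂P :=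
      pdf.integral_pdf_smul (by fun_prop)
    simpa [realPdf] using h
  have hpl : Integrable (fun w => realPdf P W w * Real.log (channelRatio s n w)) volume :=
    (pdf.integrable_pdf_smul_iff (X := W) hmlog).2 hint
  have hpl1 : ∫ w, realPdf P W w * Real.log (channelRatio s n w) =
      ∫ ω, Real.log (channelRatio s n (x ω, x ω + z ω)) ∂P :=
    pdf.integral_pdf_smul (X := W) hmlog
  set q : EuclideanSpace ℝ (Fin m) × EuclideanSpace ℝ (Fin m) → ℝ :=
    fun w => diagGaussianPDF s w.1 * realPdf P Y w.2 * channelRatio s n w with hq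
  have hq0 : ∀ w, 0 ≤ q w := fun w =>
    mul_nonneg (mul_nonneg (diagGaussianPDF_pos hs _).le ENNReal.toReal_nonneg)
      (channelRatio_pos hn w).le
  have hmY : Measurable (realPdf P Y) := (measurable_pdf Y P volume).ennreal_toReal
  have hmq : Measurable q := by fun_prop
  have hq1 : ∫⁻ w, ENNReal.ofReal (q w) ≤ 1 :=
    lintegral_backwardChannel_le hs hn (measurable_pdf Y P volume)
      (by rw [pdf.lintegral_eq_measure_univ]; exact prob_le_one)
  have hqi : Integrable q volume := by
    refine ⟨hmq.aestronglyMeasurable, ?_⟩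
    rw [hasFiniteIntegral_iff_ofReal (ae_of_all _ hq0)]
    exact hq1.trans_lt ENNReal.one_lt_top
  have hqI : ∫ w, q w ≤ 1 := by
    rw [integral_eq_lintegral_of_nonneg_ae (ae_of_all _ hq0) hmq.aestronglyMeasurable]
    exact ENNReal.toReal_le_of_le_ofReal zero_le_one (by simpa using hq1)
  have hG : Integrable (fun w => (realPdf P W w * Real.log (channelRatio s n w) +
      realPdf P W w - q w) / Real.log 2) volume := ((hpl.add hp).sub hqi).div_const _
  -- Where `p_y` vanishes the joint density must vanish too; this keeps the quotient in the
  -- logarithm meaningful wherever it carries weight.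
  have hYpos : ∀ᵐ w : EuclideanSpace ℝ (Fin m) × EuclideanSpace ℝ (Fin m),
      realPdf P W w ≠ 0 → 0 < realPdf P Y w.2 := by
    have hS : MeasurableSet {e | realPdf P Y e = 0} := hmY (measurableSet_singleton 0)
    have h0 : P.map Y {e | realPdf P Y e = 0} = 0 := by
      rw [map_eq_withDensity_pdf Y P volume, withDensity_apply _ hS,
        setLIntegral_eq_zero_iff hS (measurable_pdf _ _ _)]
      have hlt : ∀ᵐ e, pdf Y P volume e < ∞ := pdf.ae_lt_top
      filter_upwards [hlt] with e he h0
      exact ((ENNReal.toReal_eq_zero_iff _).1 h0).resolve_right he.ne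
    have h1 : P.map W (Prod.snd ⁻¹' {e | realPdf P Y e = 0}) = 0 := by
      rw [Measure.map_apply_of_aemeasurable hpdf.aemeasurable (measurable_snd hS)]
      rwa [Measure.map_apply_of_aemeasurable hy.aemeasurable hS] at h0
    rw [map_eq_withDensity_pdf W P volume, withDensity_apply _ (measurable_snd hS),
      setLIntegral_eq_zero_iff (measurable_snd hS) (measurable_pdf _ _ _)] at h1
    filter_upwards [h1] with w hw hne
    refine lt_of_le_of_ne ENNReal.toReal_nonneg fun h => hne ?_
    rw [realPdf, hw h.symm, ENNReal.toReal_zero]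
  have hXae : ∀ᵐ w : EuclideanSpace ℝ (Fin m) × EuclideanSpace ℝ (Fin m),
      realPdf P x w.1 = diagGaussianPDF s w.1 :=
    Measure.quasiMeasurePreserving_fst.ae (realPdf_ae_eq_diagGaussianPDF hs hx)
  refine le_trans ?_ (coe_integral_le_lintegral_sub hG ?_)
  -- The minorant integrates to `E log R + 1 - ∫ q`, up to the factor `1 / log 2`, and `∫ q ≤ 1`.
  · have hadd : Integrable (fun w => realPdf P W w * Real.log (channelRatio s n w) +
        realPdf P W w) volume := hpl.add hp
    rw [EReal.coe_le_coe_iff, integral_div, integral_sub hadd hqi, integral_add hpl hp, hpl1, hp1]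
    gcongr
    linarith
  · filter_upwards [hYpos, hXae] with w hw1 hw2
    rw [mutualInfoIntegrand, Real.logb, ← mul_div_assoc, hw2]
    gcongr
    have hd := diagGaussianPDF_pos hs w.1
    exact mul_log_div_ge ENNReal.toReal_nonneg (mul_nonneg hd.le ENNReal.toReal_nonneg)
      (fun h => mul_pos hd (hw1 h)) (channelRatio_pos hn w)

/-- Gaussian noise attains the bound `le_mutualInfo`. -/
lemma mutualInfo_diagGaussian {s n : Fin m → ℝ≥0} (hs : ∀ i, s i ≠ 0) (hn : ∀ i, n i ≠ 0)
    {x z : Ω → EuclideanSpace ℝ (Fin m)} (hx : HasLaw x (diagGaussian s) P)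
    (hz : HasLaw z (diagGaussian n) P) (hxz : IndepFun x z P)
    (hint : Integrable (fun ω => Real.log (channelRatio s n (x ω, x ω + z ω))) P) :
    mutualInfo P x (fun ω => x ω + z ω) =
      (((∫ ω, Real.log (channelRatio s n (x ω, x ω + z ω)) ∂P) / Real.log 2 : ℝ) : EReal) := by
  have hsn : ∀ i, (s + n) i ≠ 0 := fun i => by simp [hn i]
  have hms := measurable_diagGaussianPDF s
  have hmn := measurable_diagGaussianPDF n
  have hmlog : AEStronglyMeasurable (fun w => Real.log (channelRatio s n w)) volume :=
    (measurable_channelRatio s n).log.aestronglyMeasurable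
  have hy : HasLaw (fun ω => x ω + z ω) (diagGaussian (s + n)) P := by
    rw [← diagGaussian_conv_diagGaussian]
    exact hxz.hasLaw_fun_add hx hz
  have hx' := hx
  rw [diagGaussian_eq_withDensity hs] at hx'
  rw [diagGaussian_eq_withDensity hn] at hz
  obtain ⟨hpdf, hpdf_eq⟩ := hasPDF_prodMk_add hms.ennreal_ofReal hmn.ennreal_ofReal hx' hz hxz
  have hXae : ∀ᵐ w : EuclideanSpace ℝ (Fin m) × EuclideanSpace ℝ (Fin m),
      realPdf P x w.1 = diagGaussianPDF s w.1 :=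
    Measure.quasiMeasurePreserving_fst.ae (realPdf_ae_eq_diagGaussianPDF hs hx)
  have hYae : ∀ᵐ w : EuclideanSpace ℝ (Fin m) × EuclideanSpace ℝ (Fin m),
      realPdf P (fun ω => x ω + z ω) w.2 = diagGaussianPDF (s + n) w.2 :=
    Measure.quasiMeasurePreserving_snd.ae (realPdf_ae_eq_diagGaussianPDF hsn hy)
  have hF : (fun w => (realPdf P (fun ω => (x ω, x ω + z ω)) w *
      Real.log (channelRatio s n w)) / Real.log 2) =ᵐ[volume]
      mutualInfoIntegrand P x (fun ω => x ω + z ω) := by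
    filter_upwards [hpdf_eq, hXae, hYae] with w h1 h2 h3
    have hp : realPdf P (fun ω => (x ω, x ω + z ω)) w =
        diagGaussianPDF s w.1 * diagGaussianPDF n (w.2 - w.1) := by
      rw [realPdf, h1, ENNReal.toReal_mul, ENNReal.toReal_ofReal (diagGaussianPDF_pos hs _).le,
        ENNReal.toReal_ofReal (diagGaussianPDF_pos hn _).le]
    rw [mutualInfoIntegrand, h2, h3, hp, Real.logb, ← mul_div_assoc, channelRatio,
      mul_div_mul_left _ _ (diagGaussianPDF_pos hs _).ne']
  have hG : Integrable (fun w => (realPdf P (fun ω => (x ω, x ω + z ω)) w *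
      Real.log (channelRatio s n w)) / Real.log 2) volume :=
    ((pdf.integrable_pdf_smul_iff (X := fun ω => (x ω, x ω + z ω)) hmlog).2 hint).div_const _
  have hG1 : ∫ w, realPdf P (fun ω => (x ω, x ω + z ω)) w * Real.log (channelRatio s n w) =
      ∫ ω, Real.log (channelRatio s n (x ω, x ω + z ω)) ∂P :=
    pdf.integral_pdf_smul (X := fun ω => (x ω, x ω + z ω)) hmlog
  rw [← hG1, ← integral_div]
  refine (Eq.trans ?_ (coe_integral_eq_lintegral_sub hG).symm)
  rw [mutualInfo]
  congr 2 <;> refine lintegral_congr_ae ?_ <;> filter_upwards [hF] with w hw <;> rw [← hw]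

end MutualInfo

/-! ### The power allocation as a function of `ζ`. -/

section ObfuscatingPower

variable {ζ s : ℝ}

lemma continuous_obfuscatingPower (s : ℝ) :
    Continuous fun ζ => obfuscatingPower ζ s := by
  unfold obfuscatingPower
  refine continuous_id.div (by fun_prop) fun ζ => ?_
  positivity

lemma obfuscatingPower_nonneg (hζ : 0 ≤ ζ) : 0 ≤ obfuscatingPower ζ s := by
  unfold obfuscatingPower
  positivity

lemma obfuscatingPower_pos (hζ : 0 < ζ) : 0 < obfuscatingPower ζ s := by
  unfold obfuscatingPower
  positivity

/-- Rationalising the denominator exhibits the power as a root of `n ^ 2 + s * n = ζ * s / 4`. -/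
lemma obfuscatingPower_eq (hs : 0 < s) (hζ : 0 ≤ ζ) :
    obfuscatingPower ζ s = s / 2 * (Real.sqrt (1 + ζ / s) - 1) := by
  have h := Real.sq_sqrt (show 0 ≤ 1 + ζ / s by positivity)
  have h1 : ζ = s * (Real.sqrt (1 + ζ / s) ^ 2 - 1) := by
    rw [h]
    field_simp
    ring
  have h2 : 0 < 2 * (Real.sqrt (1 + ζ / s) + 1) := by positivity
  rw [obfuscatingPower, div_eq_iff h2.ne']
  linear_combination h1

/-- The stationarity condition of the power allocation. -/
lemma obfuscatingPower_mul_add (hs : 0 < s) (hζ : 0 ≤ ζ) :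
    obfuscatingPower ζ s * (s + obfuscatingPower ζ s) = ζ * s / 4 := by
  have h := Real.sq_sqrt (show 0 ≤ 1 + ζ / s by positivity)
  have h1 : ζ = s * (Real.sqrt (1 + ζ / s) ^ 2 - 1) := by
    rw [h]
    field_simp
    ring
  rw [obfuscatingPower_eq hs hζ]
  linear_combination -(s / 4) * h1

lemma obfuscatingPower_of_mul_add {n : ℝ} (hs : 0 < s) (hn : 0 ≤ n) :
    obfuscatingPower (4 * n * (s + n) / s) s = n := by
  rw [obfuscatingPower_eq hs (by positivity)]
  have h : 1 + 4 * n * (s + n) / s / s = (1 + 2 * n / s) ^ 2 := by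
    field_simp
    ring
  rw [h, Real.sqrt_sq (by positivity)]
  field_simp
  ring

lemma exists_sum_obfuscatingPower_eq {m : ℕ} (hm : 0 < m) {s : Fin m → ℝ} (hs : ∀ i, 0 < s i)
    {N : ℝ} (hN : 0 < N) : ∃ ζ, 0 ≤ ζ ∧ ∑ i, obfuscatingPower ζ (s i) = N := by
  have h0 := hs ⟨0, hm⟩
  -- At this `ζ` the first channel alone receives power `N`, so the total is at least `N`; at `ζ =
  -- 0` it is zero.
  set b := 4 * N * (s ⟨0, hm⟩ + N) / s ⟨0, hm⟩ with hb
  have hb0 : 0 ≤ b := by positivity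
  have hcont : ContinuousOn (fun ζ => ∑ i, obfuscatingPower ζ (s i)) (Set.Icc 0 b) :=
    (continuous_finsetSum _ fun i _ => continuous_obfuscatingPower (s i)).continuousOn
  have hle : N ≤ ∑ i, obfuscatingPower b (s i) := by
    rw [← obfuscatingPower_of_mul_add h0 hN.le]
    exact Finset.single_le_sum (f := fun i => obfuscatingPower b (s i))
      (fun i _ => obfuscatingPower_nonneg hb0) (Finset.mem_univ _)
  obtain ⟨ζ, hζ, h⟩ := intermediate_value_Icc hb0 hcont
    (show N ∈ Set.Icc _ _ from ⟨by simpa [obfuscatingPower] using hN.le, hle⟩)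
  exact ⟨ζ, hζ.1, h⟩

/-- The left side is affine in `M` and vanishes at the allotted power `n`. Its slope `-s / (2 n (s +
n))` is `-2/ζ` by stationarity, independent of `s`. -/
lemma quadratic_gap_eq (hs : 0 < s) (hζ : 0 < ζ) (M : ℝ) :
    (s + M) / (2 * (s + obfuscatingPower ζ s)) - M / (2 * obfuscatingPower ζ s) =
      2 / ζ * (obfuscatingPower ζ s - M) := by
  have h := obfuscatingPower_mul_add hs hζ.le
  have hn := obfuscatingPower_pos (s := s) hζ
  set n := obfuscatingPower ζ s
  have hz : ζ = 4 * (n * (s + n)) / s := by rw [h]; field_simp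
  rw [hz]
  field_simp
  ring

end ObfuscatingPower

/-! ### The value is a lower bound and is attained. -/

section Leakage

open scoped NNReal

variable {m : ℕ} {s n : Fin m → ℝ≥0} {ζ N : ℝ}

lemma sum_log_add_quadratic_gap (hs : ∀ i, s i ≠ 0) (hζ : 0 < ζ)
    (hn : ∀ i, (n i : ℝ) = obfuscatingPower ζ (s i)) (hN : ∑ i, (n i : ℝ) = N) (M : Fin m → ℝ) :
    (∑ i, (1 / 2 * Real.log (1 + (s i : ℝ) / n i) + (s i + M i) / (2 * (s i + n i)) -
        M i / (2 * n i))) / Real.log 2 =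
      ∑ i, 1 / 2 * Real.logb 2 (1 + (s i : ℝ) / n i) +
        2 / ζ * (N - ∑ i, M i) / Real.log 2 := by
  have h : ∀ i, 1 / 2 * Real.log (1 + (s i : ℝ) / n i) + (s i + M i) / (2 * (s i + n i)) -
      M i / (2 * n i) = 1 / 2 * Real.log (1 + (s i : ℝ) / n i) + 2 / ζ * (n i - M i) := fun i => by
    have hs' : (0 : ℝ) < s i := by have := hs i; positivity
    rw [hn, ← quadratic_gap_eq hs' hζ]
    ring
  simp_rw [h]
  rw [Finset.sum_add_distrib, ← Finset.mul_sum _ _ (2 / ζ), Finset.sum_sub_distrib, hN, add_div,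
    Finset.sum_div]
  congr 1
  exact Finset.sum_congr rfl fun i _ => by rw [Real.logb, mul_div_assoc]

lemma le_of_mem_leakageValues (hs : ∀ i, s i ≠ 0) (hζ : 0 < ζ)
    (hn : ∀ i, (n i : ℝ) = obfuscatingPower ζ (s i)) (hN : ∑ i, (n i : ℝ) = N) {I : EReal}
    (hI : I ∈ leakageValues (diagGaussian s) N) :
    ((∑ i, 1 / 2 * Real.logb 2 (1 + (s i : ℝ) / n i) : ℝ) : EReal) ≤ I := by
  obtain ⟨Ω, _, P, _, x, z, hx, hz, rfl⟩ := hI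
  have hn0 : ∀ i, n i ≠ 0 := fun i h => by
    have := obfuscatingPower_pos (s := s i) hζ
    rw [← hn, h] at this
    exact this.false
  obtain ⟨hint, heq⟩ := integrable_log_channelRatio hn0 hx hz.memLp hz.mean_zero hz.indep
  refine le_trans ?_ (le_mutualInfo hs hn0 hx hz.hasPDF hz.indep hint)
  have hpow : ∑ i, ∫ ω, (z ω i) ^ 2 ∂P ≤ N := by
    rw [← integral_finsetSum _ fun i _ => (hz.memLp.eval_piLp i).integrable_sq]
    exact hz.power
  rw [EReal.coe_le_coe_iff, heq, sum_log_add_quadratic_gap hs hζ hn hN, le_add_iff_nonneg_right]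
  have := Real.log_pos one_lt_two
  have := sub_nonneg.2 hpow
  positivity

lemma mem_leakageValues (hs : ∀ i, s i ≠ 0) (hζ : 0 < ζ)
    (hn : ∀ i, (n i : ℝ) = obfuscatingPower ζ (s i)) (hN : ∑ i, (n i : ℝ) = N) :
    ((∑ i, 1 / 2 * Real.logb 2 (1 + (s i : ℝ) / n i) : ℝ) : EReal) ∈
      leakageValues (diagGaussian s) N := by
  have hn0 : ∀ i, n i ≠ 0 := fun i h => by
    have := obfuscatingPower_pos (s := s i) hζ
    rw [← hn, h] at this
    exact this.false
  -- The optimal noise is realised on the product space, with the two projections as input and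
  -- noise.
  set P := (diagGaussian s).prod (diagGaussian n)
  have hx : HasLaw Prod.fst (diagGaussian s) P := measurePreserving_fst.hasLaw
  have hz : HasLaw Prod.snd (diagGaussian n) P := measurePreserving_snd.hasLaw
  have hxz : IndepFun Prod.fst Prod.snd P :=
    (indepFun_iff_hasLaw_prodMk_prod hx hz).2 HasLaw.id
  have hzm : MemLp (Prod.snd : _ → EuclideanSpace ℝ (Fin m)) 2 P :=
    (memLp_id_diagGaussian n).comp_measurePreserving measurePreserving_snd
  have hz0 : ∫ ω, Prod.snd ω ∂P = 0 := by
    rw [hz.integral_eq, integral_id_diagGaussian]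
  have hM : ∀ i, ∫ ω, ((Prod.snd ω : EuclideanSpace ℝ (Fin m)) i) ^ 2 ∂P = n i := fun i => by
    rw [← integral_eval_sq_diagGaussian n i]
    exact hz.integral_comp (f := fun e => (e i) ^ 2) (by fun_prop)
  have hallowed : IsAllowedNoise P Prod.fst Prod.snd N := by
    refine ⟨?_, hzm, hz0, hxz, ?_⟩
    · have hz' := hz.map_eq
      rw [diagGaussian_eq_withDensity hn0] at hz'
      exact hasPDF_of_map_eq_withDensity hz.aemeasurable _
        (measurable_diagGaussianPDF n).ennreal_ofReal.aemeasurable hz'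
    · rw [integral_finsetSum _ fun i _ => (hzm.eval_piLp i).integrable_sq]
      simp_rw [hM]
      exact hN.le
  refine ⟨_, inferInstance, P, inferInstance, Prod.fst, Prod.snd, hx, hallowed, ?_⟩
  obtain ⟨hint, heq⟩ := integrable_log_channelRatio hn0 hx hzm hz0 hxz
  rw [mutualInfo_diagGaussian hs hn0 hx hz hxz hint, heq,
    sum_log_add_quadratic_gap hs hζ hn hN]
  simp_rw [hM]
  -- The total noise power is exactly `N`, so the correction term vanishes.
  simp [hN]

end Leakage

theorem corollary1 {Ω : Type*} [MeasurableSpace Ω] (P : Measure Ω) [IsProbabilityMeasure P]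
    (m : ℕ) (hm : 0 < m) (x : Ω → EuclideanSpace ℝ (Fin m)) (hx : HasGaussianLaw x P)
    (hx_mean : ∫ ω, x ω ∂P = 0)
    (σ : Fin m → ℝ) (hσ : ∀ i, 0 < σ i)
    (hx_cov : Matrix.of (fun i j : Fin m => cov[fun ω => x ω i, fun ω => x ω j; P]) =
      Matrix.diagonal (fun i => σ i ^ 2))
    (N : ℝ) (hN : 0 < N) :
    (∃ ζ : ℝ, 0 ≤ ζ ∧ ∑ i, obfuscatingPower ζ (σ i ^ 2) = N) ∧
    ∀ ζ : ℝ, 0 ≤ ζ → ∑ i, obfuscatingPower ζ (σ i ^ 2) = N →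
      channelLeakage (P.map x) N =
          ((∑ i, 1 / 2 * Real.logb 2 (1 + σ i ^ 2 / obfuscatingPower ζ (σ i ^ 2)) : ℝ) : EReal) ∧
        IsLeast (leakageValues (P.map x) N)
          ((∑ i, 1 / 2 * Real.logb 2 (1 + σ i ^ 2 / obfuscatingPower ζ (σ i ^ 2)) : ℝ) : EReal) := by
  refine ⟨exists_sum_obfuscatingPower_eq hm (fun i => pow_pos (hσ i) 2) hN,
    fun ζ hζ hsum => ?_⟩
  -- At `ζ = 0` every power is zero, contradicting `N > 0`.
  have hζ' : 0 < ζ := by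
    refine lt_of_le_of_ne hζ fun h => hN.ne ?_
    rw [← hsum, ← h]
    simp [obfuscatingPower]
  lift σ to Fin m → NNReal using fun i => (hσ i).le
  have hs : ∀ i, (σ i) ^ 2 ≠ 0 := fun i => by
    have := hσ i
    exact pow_ne_zero 2 (NNReal.coe_pos.1 this).ne'
  have hmap : P.map x = diagGaussian fun i => (σ i) ^ 2 :=
    map_eq_diagGaussian _ hx hx_mean (by simpa using hx_cov)
  have hleast : IsLeast (leakageValues (P.map x) N) ((∑ i, 1 / 2 * Real.logb 2
      (1 + (σ i : ℝ) ^ 2 / obfuscatingPower ζ ((σ i : ℝ) ^ 2)) : ℝ) : EReal) := by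
    rw [hmap]
    have hn : ∀ i, (((obfuscatingPower ζ ((σ i : ℝ) ^ 2)).toNNReal : NNReal) : ℝ) =
        obfuscatingPower ζ (((σ i) ^ 2 : NNReal) : ℝ) := fun i => by
      rw [Real.coe_toNNReal _ (obfuscatingPower_nonneg hζ), NNReal.coe_pow]
    have hnN : ∑ i, (((obfuscatingPower ζ ((σ i : ℝ) ^ 2)).toNNReal : NNReal) : ℝ) = N := by
      simpa [hn] using hsum
    have h1 := mem_leakageValues hs hζ' hn hnN
    have h2 := fun I (hI : I ∈ leakageValues _ N) => le_of_mem_leakageValues hs hζ' hn hnN hI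
    simp only [hn, NNReal.coe_pow] at h1 h2
    exact ⟨h1, h2⟩
  exact ⟨hleast.isGLB.sInf_eq, hleast⟩
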